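/- Let $K$ be a field, $n\ge 1$, $S=K[x_1,\ldots,x_n]$, $\mathfrak m=(x_1,\ldots,x_n)$ and $\mathbf e=(1,\ldots,1)\in\mathbb Z^n$. For a monomial ideal $I\subseteq S$ let $G(I)$ be its minimal set of monomial generators. For $\mathbf c\in\mathbb Z^n$, a monomial $x_1^{a_1}\cdots x_n^{a_n}$ is called $\mathbf c$-bounded if $a_i\le c_i$ for all $i$. A monomial ideal $I$ is called $\mathbf c$-bounded strongly stable if every $u\in G(I)$ is $\mathbf c$-bounded and $x_iu/x_j\in I$ for all $u\in G(I)$ and all $i<j$ such that $x_j\mid u$ and $x_iu/x_j$ is $\mathbf c$-bounded; it is called strongly stable if $x_iu/x_j\in I$ for all $u\in G(I)$ and all $i<j$ with $x_j\mid u$. Let $B(u)$ be the smallest strongly stable ideal containing the monomial $u$. If $u$ is $\mathbf c$-bounded, let $B^{\mathbf c}(u)$ be the smallest $\mathbf c$-bounded strongly stable ideal containing $u$; if $u$ is not $\mathbf c$-bounded, let $B^{\mathbf c}(u)$ be the ideal generated by the $\mathbf c$-bounded elements of $G(B(u))$. (For $\mathbf c$-bounded $u$ the two descriptions agree.) For a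 monomial ideal $I$ put $J_0(I)=I$ and, for $\ell\ge 1$, let $J_\ell(I)$ be the ideal generated by the monomials in $(I:\mathfrak m^\ell)\setminus(I:\mathfrak m^{\ell-1})$, that is, by the monomials whose residue classes form the monomial $K$-basis of $(I:\mathfrak m^\ell)/(I:\mathfrak m^{\ell-1})$. Let $u$ be a $\mathbf c$-bounded monomial and $I=B^{\mathbf c}(u)$. Then for every positive integer $k$: (a) $I^k=B^{k\mathbf c}(u^k)$. (b) $I^k:\mathfrak m=I^k+B^{k\mathbf c-\mathbf e}(u^k/x_n)$ if $x_n\mid u$, and $I^k:\mathfrak m=I^k$ otherwise. (c) $J_\ell(I^k)=B^{k\mathbf c-\ell\mathbf e}(u^k/x_n^\ell)$ for all $\ell\ge 0$ such that $x_n^\ell\mid u^k$. -/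

import Mathlib

namespace StableIdeal

open MvPolynomial

/-! Throughout, `S = K[x_1, …, x_N]` with `N = n + 1 ≥ 1` is `MvPolynomial (Fin (n + 1)) K`; the
variable `x_N` has index `Fin.last n`, and the monomial with exponent vector `a` is
`monomial a 1`. -/

/-- A monomial ideal: an ideal generated by monomials. -/
def IsMonomialIdeal {n : ℕ} {K : Type*} [Field K] (I : Ideal (MvPolynomial (Fin (n + 1)) K)) :
    Prop :=
  ∃ A : Set (Fin (n + 1) →₀ ℕ), I = Ideal.span ((fun a => monomial a (1 : K)) '' A)

/-- `G(I)`, the minimal monomial generators of a monomial ideal `I` (as exponent vectors): the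
monomials in `I` that are minimal with respect to divisibility. -/
def minGens {n : ℕ} {K : Type*} [Field K] (I : Ideal (MvPolynomial (Fin (n + 1)) K)) :
    Set (Fin (n + 1) →₀ ℕ) :=
  {a | Minimal (fun b => monomial b (1 : K) ∈ I) a}

/-- The monomial with exponent vector `a` is `c`-bounded. -/
def IsBounded {n : ℕ} (c : Fin (n + 1) → ℤ) (a : Fin (n + 1) →₀ ℕ) : Prop :=
  ∀ i, (a i : ℤ) ≤ c i

/-- The exponent vector of `x_i u / x_j`, where `u` has exponent vector `a` and `x_j ∣ u`. -/
noncomputable def exchange {n : ℕ} (a : Fin (n + 1) →₀ ℕ) (i j : Fin (n + 1)) :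
    Fin (n + 1) →₀ ℕ :=
  a - Finsupp.single j 1 + Finsupp.single i 1

/-- Strongly stable monomial ideals (no restriction on the exponents). -/
structure IsStronglyStable {n : ℕ} {K : Type*} [Field K]
    (I : Ideal (MvPolynomial (Fin (n + 1)) K)) : Prop where
  isMonomialIdeal : IsMonomialIdeal I
  exchange_mem : ∀ a ∈ minGens I, ∀ i j, i < j → a j ≠ 0 →
    monomial (exchange a i j) (1 : K) ∈ I

/-- `c`-bounded strongly stable monomial ideals. -/
structure IsBoundedStronglyStable {n : ℕ} {K : Type*} [Field K] (c : Fin (n + 1) → ℤ)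
    (I : Ideal (MvPolynomial (Fin (n + 1)) K)) : Prop where
  isMonomialIdeal : IsMonomialIdeal I
  isBounded : ∀ a ∈ minGens I, IsBounded c a
  exchange_mem : ∀ a ∈ minGens I, ∀ i j, i < j → a j ≠ 0 → IsBounded c (exchange a i j) →
    monomial (exchange a i j) (1 : K) ∈ I

/-- `I^{≤ c}`: the ideal generated by the `c`-bounded elements of `G(I)`. -/
noncomputable def boundedPart {n : ℕ} {K : Type*} [Field K] (c : Fin (n + 1) → ℤ)
    (I : Ideal (MvPolynomial (Fin (n + 1)) K)) : Ideal (MvPolynomial (Fin (n + 1)) K) :=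
  Ideal.span ((fun a => monomial a (1 : K)) '' {a | a ∈ minGens I ∧ IsBounded c a})

/-- `B(u)`: the smallest strongly stable ideal containing the monomial `u` with exponent vector
`a`. -/
noncomputable def borel {n : ℕ} (K : Type*) [Field K] (a : Fin (n + 1) →₀ ℕ) :
    Ideal (MvPolynomial (Fin (n + 1)) K) :=
  sInf {I | IsStronglyStable I ∧ monomial a (1 : K) ∈ I}

open Classical in
/-- `B^c(u)`, where `u` has exponent vector `a`. If `u` is `c`-bounded, this is the smallest
`c`-bounded strongly stable ideal containing `u`. For a monomial `u` that is not `c`-bounded, it is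
`B(u)^{≤ c}`, an expression which for `c`-bounded `u` agrees with the former. -/
noncomputable def boundedBorel {n : ℕ} (K : Type*) [Field K] (c : Fin (n + 1) → ℤ)
    (a : Fin (n + 1) →₀ ℕ) : Ideal (MvPolynomial (Fin (n + 1)) K) :=
  if IsBounded c a then sInf {I | IsBoundedStronglyStable c I ∧ monomial a (1 : K) ∈ I}
  else boundedPart c (borel K a)

/-- `J_ℓ(I)`: `J_0(I) = I`, and for `ℓ ≥ 1` the ideal generated by the monomials that belong to
`I : 𝔪^ℓ` but not to `I : 𝔪^(ℓ-1)`; for a monomial ideal `I` these monomials represent the monomial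
`K`-basis of `(I : 𝔪^ℓ) / (I : 𝔪^(ℓ-1))`. -/
noncomputable def socleIdeal {n : ℕ} {K : Type*} [Field K] (I : Ideal (MvPolynomial (Fin (n + 1)) K)) :
    ℕ → Ideal (MvPolynomial (Fin (n + 1)) K)
  | 0 => I
  | l + 1 => Ideal.span ((fun a => monomial a (1 : K)) ''
      {a | monomial a (1 : K) ∈ I.colon ↑(idealOfVars (Fin (n + 1)) K ^ (l + 1) : Ideal _) ∧
        monomial a (1 : K) ∉ I.colon ↑(idealOfVars (Fin (n + 1)) K ^ l : Ideal _)})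

/-! The infima above are attained, so that they are indeed smallest elements. -/

theorem monomial_mem_of_le {n : ℕ} {K : Type*} [Field K]
    {I : Ideal (MvPolynomial (Fin (n + 1)) K)} {a b : Fin (n + 1) →₀ ℕ} (hab : a ≤ b)
    (ha : monomial a (1 : K) ∈ I) : monomial b (1 : K) ∈ I := by
  have h : monomial b (1 : K) = monomial (b - a) 1 * monomial a 1 := by
    rw [monomial_mul, tsub_add_cancel_of_le hab, one_mul]
  rw [h]
  exact I.mul_mem_left _ ha

theorem exists_minGens_le {n : ℕ} {K : Type*} [Field K]
    {I : Ideal (MvPolynomial (Fin (n + 1)) K)} {a : Fin (n + 1) →₀ ℕ}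
    (ha : monomial a (1 : K) ∈ I) : ∃ g ∈ minGens I, g ≤ a := by
  obtain ⟨g, hg, hm⟩ := exists_minimal_le_of_wellFoundedLT
    (fun b => monomial b (1 : K) ∈ I) a ha
  exact ⟨g, hm, hg⟩

theorem isMonomialIdeal_iff {n : ℕ} {K : Type*} [Field K]
    {I : Ideal (MvPolynomial (Fin (n + 1)) K)} :
    IsMonomialIdeal I ↔ ∀ f ∈ I, ∀ a ∈ f.support, monomial a (1 : K) ∈ I := by
  constructor
  · rintro ⟨A, rfl⟩ f hf a ha
    rw [mem_ideal_span_monomial_image] at hf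
    obtain ⟨b, hb, hba⟩ := hf a ha
    exact monomial_mem_of_le hba (Ideal.subset_span ⟨b, hb, rfl⟩)
  · intro h
    refine ⟨{a | monomial a (1 : K) ∈ I}, le_antisymm ?_ ?_⟩
    · intro f hf
      rw [mem_ideal_span_monomial_image]
      exact fun a ha => ⟨a, h f hf a ha, le_rfl⟩
    · rw [Ideal.span_le]
      rintro _ ⟨a, ha, rfl⟩
      exact ha

theorem IsMonomialIdeal.sInf {n : ℕ} {K : Type*} [Field K]
    {F : Set (Ideal (MvPolynomial (Fin (n + 1)) K))} (hF : ∀ I ∈ F, IsMonomialIdeal I) :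
    IsMonomialIdeal (sInf F) := by
  rw [isMonomialIdeal_iff]
  intro f hf a ha
  rw [Submodule.mem_sInf] at hf ⊢
  exact fun I hI => isMonomialIdeal_iff.1 (hF I hI) f (hf I hI) a ha

/-- An exchange applied to a monomial of `I` stays in `I` if the exchanges of the minimal
generators do. -/
theorem exchange_mem_of_minGens {n : ℕ} {K : Type*} [Field K]
    {I : Ideal (MvPolynomial (Fin (n + 1)) K)} {a : Fin (n + 1) →₀ ℕ} {i j : Fin (n + 1)}
    (ha : monomial a (1 : K) ∈ I)
    (h : ∀ g ∈ minGens I, g j ≠ 0 → exchange g i j ≤ exchange a i j →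
      monomial (exchange g i j) (1 : K) ∈ I) :
    monomial (exchange a i j) (1 : K) ∈ I := by
  obtain ⟨g, hg, hga⟩ := exists_minGens_le ha
  by_cases hgj : g j = 0
  · refine monomial_mem_of_le (a := g) ?_ hg.1
    intro t
    have h1 := hga t
    simp only [exchange, Finsupp.add_apply, Finsupp.tsub_apply, Finsupp.single_apply]
    by_cases htj : j = t
    · subst htj
      omega
    · simp only [htj, if_false]
      omega
  · have hle : exchange g i j ≤ exchange a i j := by
      intro t
      have h1 := hga t
      simp only [exchange, Finsupp.add_apply, Finsupp.tsub_apply, Finsupp.single_apply]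
      omega
    exact monomial_mem_of_le hle (h g hg hgj hle)

theorem isLeast_borel {n : ℕ} (K : Type*) [Field K] (a : Fin (n + 1) →₀ ℕ) :
    IsLeast {I | IsStronglyStable I ∧ monomial a (1 : K) ∈ I} (borel K a) := by
  refine ⟨⟨⟨IsMonomialIdeal.sInf fun I hI => hI.1.isMonomialIdeal, ?_⟩, ?_⟩,
    fun I hI => sInf_le hI⟩
  · intro b hb i j hij _
    refine Submodule.mem_sInf.2 fun I hI => ?_
    exact exchange_mem_of_minGens (Submodule.mem_sInf.1 hb.1 I hI)
      fun g hg hgj _ => hI.1.exchange_mem g hg i j hij hgj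
  · exact Submodule.mem_sInf.2 fun I hI => hI.2

theorem isLeast_boundedBorel {n : ℕ} (K : Type*) [Field K] {c : Fin (n + 1) → ℤ}
    {a : Fin (n + 1) →₀ ℕ} (ha : IsBounded c a) :
    IsLeast {I | IsBoundedStronglyStable c I ∧ monomial a (1 : K) ∈ I} (boundedBorel K c a) := by
  rw [boundedBorel, if_pos ha]
  refine ⟨⟨⟨IsMonomialIdeal.sInf fun I hI => hI.1.isMonomialIdeal, ?_, ?_⟩, ?_⟩,
    fun I hI => sInf_le hI⟩
  · intro b hb
    let b' : Fin (n + 1) →₀ ℕ := Finsupp.equivFunOnFinite.symm fun i => min (b i) (c i).toNat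
    have hb' : b' ≤ b := fun i => min_le_left _ _
    have hmem : monomial b' (1 : K) ∈
        sInf {I | IsBoundedStronglyStable c I ∧ monomial a (1 : K) ∈ I} := by
      refine Submodule.mem_sInf.2 fun I hI => ?_
      obtain ⟨g, hg, hgb⟩ := exists_minGens_le (Submodule.mem_sInf.1 hb.1 I hI)
      refine monomial_mem_of_le (fun i => le_min (hgb i) ?_) hg.1
      have := hI.1.isBounded g hg i
      omega
    intro i
    have h1 : b i ≤ (c i).toNat := (hb.2 hmem hb' i).trans (min_le_right _ _)
    have h2 := ha i
    omega
  · intro b hb i j hij _ hbd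
    refine Submodule.mem_sInf.2 fun I hI => ?_
    refine exchange_mem_of_minGens (Submodule.mem_sInf.1 hb.1 I hI)
      fun g hg hgj hle => hI.1.exchange_mem g hg i j hij hgj fun t => ?_
    have h1 := hle t
    have h2 := hbd t
    omega
  · exact Submodule.mem_sInf.2 fun I hI => hI.2

end StableIdeal

open MvPolynomial StableIdeal

/-!
For a monomial `u` of degree `d` with exponent vector `a`, everything reduces to a description of
`B^c(u)` by inequalities: it is generated by the `c`-bounded monomials `b` of degree `d` whose
prefix sums `b_1 + ⋯ + b_t` are at least those of `a` (`boundedBorel_eq_span`). This set `borelGens`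
is closed under bounded exchanges, and conversely `exists_exchange_toward` leads from `a` to any of
its elements by exchanges that stay within the bounds. The description also holds when `u` is not
`c`-bounded; this matters because shifting the bounds by `e` may leave `u / x_N` unbounded.

The generators of a `k`-th power of such an ideal are the `k`-fold sums of elements of
`borelGens c a`. That these sums fill all of `borelGens (k c) (k a)` is an integer decomposition
property: one summand splits off by dividing all prefix sums by `k` and rounding down
(`exists_add_eq_of_mem_borelGens`).

So the powers of `B^c(u)` are again ideals of the form `J = B^c(u)`, for other `c` and `u`, and for
the colon ideals and the ideals `J_l` only the first power has to be considered. If `v ∉ J` but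
`x_j v ∈ J` for all `j`, then `x_N v` is a generator of `J`, because otherwise an exchange against
`x_N` would produce a generator dividing `v`; and every exponent of `v` is less than its bound
(`mem_borelGens_of_socle`). So `v` has degree `d - 1`, is `(c - e)`-bounded, and satisfies the
inequalities for all prefix sums but the last: it is a generator of `B^(c-e)(u/x_N)`. Similarly, a
monomial of `(J : 𝔪^(l+1)) \ (J : 𝔪^l)` has a multiple of this kind by a monomial of degree `l`. It
therefore has degree `d - (l+1)`, so that its products with the `x_j^(l+1)` are generators of `J`,
which gives the inequalities for `B^(c-(l+1)e)(u/x_N^(l+1))` (`monomial_mem_colon_diff_iff`).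
-/

namespace StableIdeal

variable {n : ℕ} {K : Type*} [Field K]

/-! ### Prefix sums -/

/-- The degree of the monomial with exponent vector `a` in the variables of index at most `t`. -/
def prefixSum (t : Fin (n + 1)) (a : Fin (n + 1) →₀ ℕ) : ℕ := ∑ s ∈ Finset.Iic t, a s

theorem prefixSum_add (t : Fin (n + 1)) (a b : Fin (n + 1) →₀ ℕ) :
    prefixSum t (a + b) = prefixSum t a + prefixSum t b := by
  simp [prefixSum, Finset.sum_add_distrib]

theorem prefixSum_nsmul (t : Fin (n + 1)) (k : ℕ) (a : Fin (n + 1) →₀ ℕ) :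
    prefixSum t (k • a) = k * prefixSum t a := by
  simp [prefixSum, Finset.mul_sum]

theorem prefixSum_single (t i : Fin (n + 1)) (m : ℕ) :
    prefixSum t (Finsupp.single i m) = if i ≤ t then m else 0 := by
  simp [prefixSum, Finsupp.single_apply]

theorem prefixSum_last (a : Fin (n + 1) →₀ ℕ) : prefixSum (Fin.last n) a = a.degree := by
  rw [prefixSum, Finsupp.degree_eq_sum]
  congr 1
  ext s
  simp [Fin.le_last]

theorem prefixSum_zero (a : Fin (n + 1) →₀ ℕ) : prefixSum 0 a = a 0 := by
  have : Finset.Iic (0 : Fin (n + 1)) = {0} := by ext s; simp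
  simp [prefixSum, this]

theorem prefixSum_succ (a : Fin (n + 1) →₀ ℕ) (i : Fin n) :
    prefixSum i.succ a = prefixSum i.castSucc a + a i.succ := by
  have : Finset.Iic i.succ = insert i.succ (Finset.Iic i.castSucc) := by
    ext s
    simp only [Finset.mem_Iic, Finset.mem_insert, Fin.le_def, Fin.ext_iff, Fin.val_succ,
      Fin.val_castSucc]
    omega
  rw [prefixSum, this, Finset.sum_insert (by simp [Fin.le_def]), add_comm]
  rfl

theorem eq_of_le_of_degree_le {a b : Fin (n + 1) →₀ ℕ} (h : a ≤ b) (hd : b.degree ≤ a.degree) :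
    a = b := by
  obtain ⟨x, rfl⟩ := le_iff_exists_add.1 h
  rw [map_add] at hd
  rw [(Finsupp.degree_eq_zero_iff x).1 (by omega), add_zero]

/-! ### Exchanges -/

theorem exchange_add_single {a : Fin (n + 1) →₀ ℕ} {i j : Fin (n + 1)} (hj : a j ≠ 0) :
    exchange a i j + Finsupp.single j 1 = a + Finsupp.single i 1 := by
  have h : Finsupp.single j 1 ≤ a := by
    rw [Finsupp.single_le_iff]
    omega
  rw [exchange, add_right_comm, tsub_add_cancel_of_le h]

theorem prefixSum_exchange {a : Fin (n + 1) →₀ ℕ} {i j : Fin (n + 1)} (hj : a j ≠ 0)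
    (t : Fin (n + 1)) :
    prefixSum t (exchange a i j) + (if j ≤ t then 1 else 0) =
      prefixSum t a + if i ≤ t then 1 else 0 := by
  have h := congrArg (prefixSum t) (exchange_add_single (i := i) hj)
  rwa [prefixSum_add, prefixSum_add, prefixSum_single, prefixSum_single] at h

theorem degree_exchange {a : Fin (n + 1) →₀ ℕ} {i j : Fin (n + 1)} (hj : a j ≠ 0) :
    (exchange a i j).degree = a.degree := by
  have h := congrArg Finsupp.degree (exchange_add_single (i := i) hj)
  simpa using h

theorem prefixSum_le_exchange {a : Fin (n + 1) →₀ ℕ} {i j : Fin (n + 1)} (hij : i < j)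
    (hj : a j ≠ 0) (t : Fin (n + 1)) : prefixSum t a ≤ prefixSum t (exchange a i j) := by
  have h := prefixSum_exchange (i := i) hj t
  have : j ≤ t → i ≤ t := fun h => hij.le.trans h
  split_ifs at h <;> omega

/-- One step of an exchange path from `a` to a larger element `b` in the order given by prefix
sums. -/
theorem exists_exchange_toward {a b : Fin (n + 1) →₀ ℕ} (hd : b.degree = a.degree)
    (hp : ∀ t, prefixSum t a ≤ prefixSum t b) (hne : a ≠ b) :
    ∃ i j, i < j ∧ a i < b i ∧ b j < a j ∧
      ∀ t, prefixSum t (exchange a i j) ≤ prefixSum t b := by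
  have hex : ∃ j, b j < a j := by
    by_contra! h
    exact hne (eq_of_le_of_degree_le h hd.le)
  obtain ⟨j, hj, hmin⟩ := exists_minimal_of_wellFoundedLT (fun j => b j < a j) hex
  have hlt : ∀ s, s < j → a s ≤ b s := by
    intro s hs
    by_contra! h
    exact absurd (hmin h hs.le) (not_le.2 hs)
  obtain ⟨i, hij, hi⟩ : ∃ i, i < j ∧ a i < b i := by
    by_contra! h
    refine absurd (hp j) (not_le.2 ?_)
    refine Finset.sum_lt_sum (fun s hs => ?_) ⟨j, Finset.mem_Iic.2 le_rfl, hj⟩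
    rcases (Finset.mem_Iic.1 hs).lt_or_eq with h1 | rfl
    · exact h s h1
    · exact hj.le
  refine ⟨i, j, hij, hi, hj, fun t => ?_⟩
  have h := prefixSum_exchange (a := a) (i := i) (j := j) (by omega) t
  have h0 := hp t
  by_cases hjt : j ≤ t
  · rw [if_pos hjt, if_pos (hij.le.trans hjt)] at h
    omega
  · by_cases hit : i ≤ t
    · -- Before `j` no exponent of `a` exceeds that of `b`, and at `i` it is smaller.
      have h1 : prefixSum t a < prefixSum t b :=
        Finset.sum_lt_sum (fun s hs => hlt s ((Finset.mem_Iic.1 hs).trans_lt (not_le.1 hjt)))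
          ⟨i, Finset.mem_Iic.2 hit, hi⟩
      rw [if_neg hjt, if_pos hit] at h
      omega
    · rw [if_neg hjt, if_neg hit] at h
      omega

/-! ### The generators of a bounded principal Borel ideal -/

/-- The exponent vectors of the degree of `a` that are `c`-bounded and whose prefix sums are at
least those of `a`; these turn out to be the minimal generators of `B^c(u)`, where `u` has exponent
vector `a`. The vector `a` itself need not be `c`-bounded. -/
def borelGens (c : Fin (n + 1) → ℤ) (a : Fin (n + 1) →₀ ℕ) : Set (Fin (n + 1) →₀ ℕ) :=
  {b | b.degree = a.degree ∧ (∀ t, prefixSum t a ≤ prefixSum t b) ∧ IsBounded c b}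

theorem monomial_mem_span_iff {A : Set (Fin (n + 1) →₀ ℕ)} {v : Fin (n + 1) →₀ ℕ} :
    monomial v (1 : K) ∈ Ideal.span ((fun a => monomial a (1 : K)) '' A) ↔ ∃ b ∈ A, b ≤ v := by
  classical
  rw [mem_ideal_span_monomial_image]
  simp [support_monomial]

theorem minGens_span_of_degree_eq {A : Set (Fin (n + 1) →₀ ℕ)} {d : ℕ}
    (hA : ∀ b ∈ A, b.degree = d) :
    minGens (Ideal.span ((fun a => monomial a (1 : K)) '' A)) = A := by
  ext v
  constructor
  · rintro ⟨hv, hmin⟩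
    obtain ⟨b, hb, hbv⟩ := monomial_mem_span_iff.1 hv
    exact le_antisymm (hmin (monomial_mem_span_iff.2 ⟨b, hb, le_rfl⟩) hbv) hbv ▸ hb
  · refine fun hv => ⟨monomial_mem_span_iff.2 ⟨v, hv, le_rfl⟩, fun w hw hwv => ?_⟩
    obtain ⟨b, hb, hbw⟩ := monomial_mem_span_iff.1 hw
    have hbv := eq_of_le_of_degree_le (hbw.trans hwv) (by rw [hA v hv, hA b hb])
    exact hbv ▸ hbw

theorem minGens_span_borelGens (c : Fin (n + 1) → ℤ) (a : Fin (n + 1) →₀ ℕ) :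
    minGens (Ideal.span ((fun a => monomial a (1 : K)) '' borelGens c a)) = borelGens c a :=
  minGens_span_of_degree_eq fun _ hb => hb.1

theorem exchange_mem_borelGens {c : Fin (n + 1) → ℤ} {a b : Fin (n + 1) →₀ ℕ}
    (hb : b ∈ borelGens c a) {i j : Fin (n + 1)} (hij : i < j) (hj : b j ≠ 0)
    (hc : IsBounded c (exchange b i j)) : exchange b i j ∈ borelGens c a :=
  ⟨(degree_exchange hj).trans hb.1,
    fun t => (hb.2.1 t).trans (prefixSum_le_exchange hij hj t), hc⟩

/-- An ideal that contains `a` and is closed under `c`-bounded exchanges contains every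
`b ∈ borelGens c a`: exchanges lead from `a` to `b`, and the exponents on the way stay below the
maxima of those of `a` and `b`. -/
theorem monomial_mem_of_exchange_closed {I : Ideal (MvPolynomial (Fin (n + 1)) K)}
    {c : Fin (n + 1) → ℤ} {b : Fin (n + 1) →₀ ℕ}
    (hI : ∀ x, monomial x (1 : K) ∈ I → ∀ i j, i < j → x j ≠ 0 → IsBounded c (exchange x i j) →
      monomial (exchange x i j) (1 : K) ∈ I)
    (hbc : IsBounded c b) (a : Fin (n + 1) →₀ ℕ) (hac : IsBounded c a)
    (ha : monomial a (1 : K) ∈ I) (hd : b.degree = a.degree)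
    (hp : ∀ t, prefixSum t a ≤ prefixSum t b) : monomial b (1 : K) ∈ I := by
  by_cases hne : a = b
  · exact hne ▸ ha
  obtain ⟨i, j, hij, hi, hj, hpt⟩ := exists_exchange_toward hd hp hne
  have hj0 : a j ≠ 0 := by omega
  have hval : ∀ s, exchange a i j s =
      (a s - if j = s then 1 else 0) + if i = s then 1 else 0 := fun s => by
    simp [exchange, Finsupp.single_apply]
  have hbd : IsBounded c (exchange a i j) := by
    intro s
    have h1 := hac s
    have h2 := hbc s
    rw [hval]
    by_cases his : i = s
    · subst his
      simp only [if_true, hij.ne', if_false]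
      omega
    · simp only [his, if_false]
      omega
  have hdec : ∑ s, (b s - exchange a i j s) < ∑ s, (b s - a s) := by
    refine Finset.sum_lt_sum (fun s _ => ?_) ⟨i, Finset.mem_univ _, ?_⟩
    · rw [hval]
      by_cases hjs : j = s
      · subst hjs
        simp only [if_true, hij.ne, if_false]
        omega
      · simp only [hjs, if_false]
        omega
    · rw [hval]
      simp only [if_true, hij.ne', if_false]
      omega
  exact monomial_mem_of_exchange_closed hI hbc (exchange a i j) hbd (hI a ha i j hij hj0 hbd)
    (hd.trans (degree_exchange hj0).symm) hpt
termination_by ∑ s, (b s - a s)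

theorem borel_eq_span (a : Fin (n + 1) →₀ ℕ) :
    borel K a = Ideal.span ((fun a => monomial a (1 : K)) ''
      {b | b.degree = a.degree ∧ ∀ t, prefixSum t a ≤ prefixSum t b}) := by
  apply le_antisymm
  · refine (isLeast_borel K a).2 ⟨⟨⟨_, rfl⟩, fun b hb i j hij hj => ?_⟩,
      monomial_mem_span_iff.2 ⟨a, ⟨rfl, fun _ => le_rfl⟩, le_rfl⟩⟩
    rw [minGens_span_of_degree_eq fun _ hb => hb.1] at hb
    exact monomial_mem_span_iff.2 ⟨_, ⟨(degree_exchange hj).trans hb.1,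
      fun t => (hb.2 t).trans (prefixSum_le_exchange hij hj t)⟩, le_rfl⟩
  · rw [Ideal.span_le]
    rintro _ ⟨b, hb, rfl⟩
    obtain ⟨hs, ha⟩ := (isLeast_borel K a).1
    refine monomial_mem_of_exchange_closed (c := fun i => (a i : ℤ) + b i)
      (fun x hx i j hij _ _ => exchange_mem_of_minGens hx
        fun g hg hgj _ => hs.exchange_mem g hg i j hij hgj)
      (fun i => ?_) a (fun i => ?_) ha hb.1 hb.2
    · dsimp only
      omega
    · dsimp only
      omega

theorem boundedBorel_eq_span (c : Fin (n + 1) → ℤ) (a : Fin (n + 1) →₀ ℕ) :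
    boundedBorel K c a = Ideal.span ((fun a => monomial a (1 : K)) '' borelGens c a) := by
  by_cases ha : IsBounded c a
  · obtain ⟨⟨hs, hmem⟩, hle⟩ := isLeast_boundedBorel K ha
    apply le_antisymm
    · refine hle ⟨⟨⟨_, rfl⟩, fun b hb => ?_, fun b hb i j hij hj hc => ?_⟩,
        monomial_mem_span_iff.2 ⟨a, ⟨rfl, fun _ => le_rfl, ha⟩, le_rfl⟩⟩
      · rw [minGens_span_borelGens] at hb
        exact hb.2.2
      · rw [minGens_span_borelGens] at hb
        exact monomial_mem_span_iff.2 ⟨_, exchange_mem_borelGens hb hij hj hc, le_rfl⟩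
    · rw [Ideal.span_le]
      rintro _ ⟨b, hb, rfl⟩
      refine monomial_mem_of_exchange_closed (c := c)
        (fun x hx i j hij _ hc => exchange_mem_of_minGens hx
          fun g hg hgj hg_le => hs.exchange_mem g hg i j hij hgj fun s => ?_)
        hb.2.2 a ha hmem hb.1 hb.2.1
      have h1 := hg_le s
      have h2 := hc s
      omega
  · rw [boundedBorel, if_neg ha, boundedPart, borel_eq_span,
      minGens_span_of_degree_eq fun _ hb => hb.1]
    simp only [borelGens, Set.mem_ofPred_eq, and_assoc]

/-! ### Powers -/

theorem div_sub_div_bounds {m x y : ℕ} (hm : 0 < m) (hy : y ≤ x) :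
    x - y < m * (x / m - y / m) + m ∧ m * (x / m - y / m) < x - y + m := by
  have hx1 := Nat.div_add_mod x m
  have hx2 := Nat.mod_lt x hm
  have hy1 := Nat.div_add_mod y m
  have hy2 := Nat.mod_lt y hm
  have h := Nat.mul_le_mul_left m (Nat.div_le_div_right (c := m) hy)
  rw [Nat.mul_sub]
  omega

/-- The integer decomposition property: an element of `borelGens ((m + 1) c) ((m + 1) a)` splits
into an element of `borelGens (m c) (m a)` and one of `borelGens c a`. The latter has the prefix
sums `⌊P / (m + 1)⌋`, where `P` runs through the prefix sums of the given element; since the bounds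
on `P / (m + 1)` and on its increments are integers, rounding keeps them. -/
theorem exists_add_eq_of_mem_borelGens {m : ℕ} {c : Fin (n + 1) → ℤ} {a b : Fin (n + 1) →₀ ℕ}
    (hb : b ∈ borelGens (fun i => ((m + 1 : ℕ) : ℤ) * c i) ((m + 1) • a)) :
    ∃ x ∈ borelGens (fun i => (m : ℤ) * c i) (m • a), ∃ y ∈ borelGens c a, x + y = b := by
  obtain ⟨hd, hp, hbd⟩ := hb
  rw [map_nsmul, smul_eq_mul] at hd
  simp only [prefixSum_nsmul] at hp
  have hle : ∀ t, b t ≤ prefixSum t b := fun t =>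
    Finset.single_le_sum (f := fun s => b s) (fun _ _ => Nat.zero_le _) (Finset.mem_Iic.2 le_rfl)
  let y : Fin (n + 1) →₀ ℕ := Finsupp.equivFunOnFinite.symm fun t =>
    prefixSum t b / (m + 1) - (prefixSum t b - b t) / (m + 1)
  have hyv : ∀ t, y t = prefixSum t b / (m + 1) - (prefixSum t b - b t) / (m + 1) :=
    fun t => rfl
  have hy : ∀ t, prefixSum t y = prefixSum t b / (m + 1) := by
    intro t
    induction t using Fin.induction with
    | zero => rw [prefixSum_zero, hyv, prefixSum_zero]; simp
    | succ i ih =>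
      rw [prefixSum_succ, ih, hyv, prefixSum_succ, Nat.add_sub_cancel]
      exact Nat.add_sub_cancel' (Nat.div_le_div_right (Nat.le_add_right _ _))
  have hyb : ∀ t, b t < (m + 1) * y t + (m + 1) ∧ (m + 1) * y t < b t + (m + 1) := by
    intro t
    have h := div_sub_div_bounds (m := m + 1) (by omega) (Nat.sub_le (prefixSum t b) (b t))
    rwa [Nat.sub_sub_self (hle t), ← hyv] at h
  have hyle : y ≤ b := by
    intro t
    have h := (hyb t).2
    by_contra! hlt
    nlinarith
  have hydeg : y.degree = a.degree := by
    rw [← prefixSum_last, hy, prefixSum_last, hd, Nat.mul_div_cancel_left _ (by omega)]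
  have hyp : ∀ t, prefixSum t a ≤ prefixSum t y := fun t => by
    rw [hy, Nat.le_div_iff_mul_le (by omega), mul_comm]
    exact hp t
  obtain ⟨x, hx⟩ := le_iff_exists_add'.1 hyle
  refine ⟨x, ⟨?_, fun t => ?_, fun t => ?_⟩, y, ⟨hydeg, hyp, fun t => ?_⟩, hx.symm⟩
  · have h := congrArg Finsupp.degree hx
    rw [map_add, hd, hydeg, add_mul] at h
    rw [map_nsmul, smul_eq_mul]
    omega
  · have h := congrArg (prefixSum t) hx
    have h1 := Nat.div_mul_le_self (prefixSum t b) (m + 1)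
    have h2 := Nat.mul_le_mul_left m (hyp t)
    rw [prefixSum_add] at h
    rw [← hy, mul_add, mul_comm _ m] at h1
    rw [prefixSum_nsmul]
    omega
  · have h1 := hbd t
    have h2 : b t = x t + y t := by rw [hx]; rfl
    have h3 : (b t : ℤ) < (m + 1) * y t + (m + 1) := mod_cast (hyb t).1
    push_cast [h2] at h1 h3
    dsimp only
    by_contra! h4
    have h5 : (y t : ℤ) + 1 ≤ c t := by linarith
    have h6 := mul_le_mul_of_nonneg_left h5 (Int.natCast_nonneg m)
    linarith
  · have h1 := hbd t
    have h3 : ((m + 1) * y t : ℤ) < b t + (m + 1) := mod_cast (hyb t).2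
    push_cast at h1
    by_contra! h4
    nlinarith

theorem add_mem_borelGens {c c' : Fin (n + 1) → ℤ} {a a' x y : Fin (n + 1) →₀ ℕ}
    (hx : x ∈ borelGens c a) (hy : y ∈ borelGens c' a') :
    x + y ∈ borelGens (fun i => c i + c' i) (a + a') := by
  refine ⟨by rw [map_add, map_add, hx.1, hy.1], fun t => ?_, fun t => ?_⟩
  · rw [prefixSum_add, prefixSum_add]
    exact add_le_add (hx.2.1 t) (hy.2.1 t)
  · have h1 := hx.2.2 t
    have h2 := hy.2.2 t
    rw [Finsupp.add_apply]
    push_cast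
    omega

theorem span_borelGens_pow (c : Fin (n + 1) → ℤ) (a : Fin (n + 1) →₀ ℕ) (k : ℕ) :
    Ideal.span ((fun a => monomial a (1 : K)) '' borelGens c a) ^ k =
      Ideal.span ((fun a => monomial a (1 : K)) ''
        borelGens (fun i => (k : ℤ) * c i) (k • a)) := by
  induction k with
  | zero =>
    rw [pow_zero, eq_comm, Ideal.one_eq_top, Ideal.eq_top_iff_one]
    refine monomial_mem_span_iff.2 ⟨0, ⟨by simp, by simp, fun i => ?_⟩, le_rfl⟩
    simp
  | succ m ih =>
    rw [pow_succ, ih, Ideal.span_mul_span']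
    congr 1
    ext f
    rw [Set.mem_mul]
    constructor
    · rintro ⟨_, ⟨x, hx, rfl⟩, _, ⟨y, hy, rfl⟩, rfl⟩
      refine ⟨x + y, ?_, by simp [monomial_mul]⟩
      have h := add_mem_borelGens hx hy
      rw [← succ_nsmul] at h
      simpa only [Nat.cast_succ, add_mul, one_mul] using h
    · rintro ⟨b, hb, rfl⟩
      obtain ⟨x, hx, y, hy, rfl⟩ := exists_add_eq_of_mem_borelGens hb
      exact ⟨_, ⟨x, hx, rfl⟩, _, ⟨y, hy, rfl⟩, by simp [monomial_mul]⟩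

/-! ### Colon ideals -/

theorem monomial_mem_colon_pow_iff {I : Ideal (MvPolynomial (Fin (n + 1)) K)} {l : ℕ}
    {v : Fin (n + 1) →₀ ℕ} :
    monomial v (1 : K) ∈ I.colon ↑(idealOfVars (Fin (n + 1)) K ^ l : Ideal _) ↔
      ∀ w : Fin (n + 1) →₀ ℕ, w.degree = l → monomial (v + w) (1 : K) ∈ I := by
  rw [Submodule.mem_colon]
  constructor
  · intro h w hw
    have h1 := h (monomial w 1) (by
      rw [pow_idealOfVars_eq_span]
      exact Ideal.subset_span ⟨w, hw, rfl⟩)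
    simpa [monomial_mul] using h1
  · intro h p hp
    rw [SetLike.mem_coe, pow_idealOfVars_eq_span] at hp
    induction hp using Submodule.span_induction with
    | mem p hp =>
      obtain ⟨w, hw, rfl⟩ := hp
      simpa [monomial_mul] using h w hw
    | zero => simp
    | add p q _ _ hp hq => rw [smul_add]; exact I.add_mem hp hq
    | smul r p _ hp => rw [smul_comm]; exact I.smul_mem r hp

theorem monomial_mem_colon_idealOfVars_iff {I : Ideal (MvPolynomial (Fin (n + 1)) K)}
    {v : Fin (n + 1) →₀ ℕ} :
    monomial v (1 : K) ∈ I.colon (idealOfVars (Fin (n + 1)) K) ↔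
      ∀ j, monomial (v + Finsupp.single j 1) (1 : K) ∈ I := by
  have h := monomial_mem_colon_pow_iff (I := I) (l := 1) (v := v)
  rw [pow_one] at h
  refine h.trans ⟨fun h j => h _ (by simp), fun h w hw => ?_⟩
  obtain ⟨j, hj⟩ : w.support.Nonempty := by
    rw [Finsupp.support_nonempty_iff]
    rintro rfl
    simp at hw
  have hle : Finsupp.single j 1 ≤ w :=
    Finsupp.single_le_iff.2 (Nat.one_le_iff_ne_zero.2 (Finsupp.mem_support_iff.1 hj))
  exact monomial_mem_of_le (add_le_add_right hle v) (h j)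

theorem IsMonomialIdeal.colon_idealOfVars {I : Ideal (MvPolynomial (Fin (n + 1)) K)}
    (hI : IsMonomialIdeal I) : IsMonomialIdeal (I.colon (idealOfVars (Fin (n + 1)) K)) := by
  rw [isMonomialIdeal_iff] at hI ⊢
  intro f hf v hv
  refine monomial_mem_colon_idealOfVars_iff.2 fun j => ?_
  have h := Submodule.mem_colon.1 hf (X j) (Ideal.subset_span ⟨j, rfl⟩)
  refine hI _ h _ ?_
  rw [smul_eq_mul, mem_support_iff, coeff_mul_X]
  exact mem_support_iff.1 hv

/-- Monomial ideals are compared on monomials. -/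
theorem IsMonomialIdeal.le_iff {I J : Ideal (MvPolynomial (Fin (n + 1)) K)}
    (hI : IsMonomialIdeal I) :
    I ≤ J ↔ ∀ v, monomial v (1 : K) ∈ I → monomial v (1 : K) ∈ J := by
  refine ⟨fun h v hv => h hv, fun h => ?_⟩
  obtain ⟨A, rfl⟩ := hI
  rw [Ideal.span_le]
  rintro _ ⟨v, hv, rfl⟩
  exact h v (Ideal.subset_span ⟨v, hv, rfl⟩)

/-- A monomial `v` outside `J = B^c(u)` with `x_j v ∈ J` for all `j` becomes a generator of `J` on
multiplication by the last variable, and all its exponents are less than the bounds. -/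
theorem mem_borelGens_of_socle {c : Fin (n + 1) → ℤ} {a v : Fin (n + 1) →₀ ℕ}
    (hv : ¬ ∃ b ∈ borelGens c a, b ≤ v)
    (h : ∀ j, ∃ b ∈ borelGens c a, b ≤ v + Finsupp.single j 1) :
    v + Finsupp.single (Fin.last n) 1 ∈ borelGens c a ∧ ∀ j, (v j : ℤ) + 1 ≤ c j := by
  -- A generator dividing `x_j v` but not `v` has the exponent of `x_j v` at `j`.
  have key : ∀ j, ∀ b ∈ borelGens c a, b ≤ v + Finsupp.single j 1 → b j = v j + 1 := by
    intro j b hb hle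
    by_contra hne
    refine hv ⟨b, hb, fun s => ?_⟩
    have hs := hle s
    rw [Finsupp.add_apply, Finsupp.single_apply] at hs
    split_ifs at hs with hjs
    · subst hjs
      omega
    · exact hs
  have hc : ∀ j, (v j : ℤ) + 1 ≤ c j := by
    intro j
    obtain ⟨b, hb, hle⟩ := h j
    have h1 := key j b hb hle
    have h2 := hb.2.2 j
    omega
  refine ⟨?_, hc⟩
  obtain ⟨b, hb, hle⟩ := h (Fin.last n)
  have hlast := key _ b hb hle
  suffices b = v + Finsupp.single (Fin.last n) 1 from this ▸ hb
  refine le_antisymm hle fun s => ?_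
  by_contra! hlt
  have hs : s ≠ Fin.last n := by
    rintro rfl
    simp [hlast] at hlt
  have hbs : b s < v s := by simpa [hs.symm] using hlt
  -- Otherwise an exchange turns `b` into a generator that divides `v`.
  have hval : ∀ t, exchange b s (Fin.last n) t ≤ v t := by
    intro t
    have ht := hle t
    simp only [exchange, Finsupp.add_apply, Finsupp.tsub_apply, Finsupp.single_apply] at ht ⊢
    by_cases hst : s = t
    · subst hst
      simp only [hs.symm, if_false, if_true]
      omega
    · simp only [hst, if_false]
      omega
  refine hv ⟨_, exchange_mem_borelGens hb (Fin.lt_last_iff_ne_last.2 hs) (by omega)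
    fun t => ?_, hval⟩
  have h1 := hval t
  have h2 := hc t
  omega

theorem prefixSum_tsub_single {a : Fin (n + 1) →₀ ℕ} {l : ℕ} (hl : l ≤ a (Fin.last n))
    {t : Fin (n + 1)} (ht : t ≠ Fin.last n) :
    prefixSum t (a - Finsupp.single (Fin.last n) l) = prefixSum t a := by
  have h := congrArg (prefixSum t) (tsub_add_cancel_of_le (Finsupp.single_le_iff.2 hl))
  rwa [prefixSum_add, prefixSum_single, if_neg (fun h => ht (Fin.last_le_iff.1 h)), add_zero] at h

theorem degree_tsub_single {a : Fin (n + 1) →₀ ℕ} {l : ℕ} (hl : l ≤ a (Fin.last n)) :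
    (a - Finsupp.single (Fin.last n) l).degree + l = a.degree := by
  have h := congrArg Finsupp.degree (tsub_add_cancel_of_le (Finsupp.single_le_iff.2 hl))
  simpa using h

theorem mem_borelGens_tsub_iff {c : Fin (n + 1) → ℤ} {a v : Fin (n + 1) →₀ ℕ} {l : ℕ}
    (hl : l ≤ a (Fin.last n)) :
    v ∈ borelGens (fun i => c i - l) (a - Finsupp.single (Fin.last n) l) ↔
      v.degree + l = a.degree ∧ (∀ t, t ≠ Fin.last n → prefixSum t a ≤ prefixSum t v) ∧
        ∀ i, (v i : ℤ) + l ≤ c i := by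
  have hd := degree_tsub_single hl
  constructor
  · rintro ⟨h1, h2, h3⟩
    refine ⟨by omega, fun t ht => ?_, fun i => ?_⟩
    · rw [← prefixSum_tsub_single hl ht]
      exact h2 t
    · have := h3 i
      dsimp only at this
      omega
  · rintro ⟨h1, h2, h3⟩
    refine ⟨by omega, fun t => ?_, fun i => ?_⟩
    · by_cases ht : t = Fin.last n
      · rw [ht, prefixSum_last, prefixSum_last]
        omega
      · rw [prefixSum_tsub_single hl ht]
        exact h2 t ht
    · have := h3 i
      dsimp only
      omega

theorem add_mem_borelGens_of_degree_eq {c : Fin (n + 1) → ℤ} {a v w : Fin (n + 1) →₀ ℕ} {l : ℕ}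
    (hl : l ≤ a (Fin.last n))
    (hv : v ∈ borelGens (fun i => c i - l) (a - Finsupp.single (Fin.last n) l))
    (hw : w.degree = l) : v + w ∈ borelGens c a := by
  obtain ⟨h1, h2, h3⟩ := (mem_borelGens_tsub_iff hl).1 hv
  refine ⟨by rw [map_add, hw, h1], fun t => ?_, fun i => ?_⟩
  · by_cases ht : t = Fin.last n
    · rw [ht, prefixSum_last, prefixSum_last, map_add]
      omega
    · rw [prefixSum_add]
      exact (h2 t ht).trans (Nat.le_add_right _ _)
  · have h4 := Finsupp.le_degree i w
    have h5 := h3 i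
    rw [Finsupp.add_apply]
    push_cast
    omega

theorem colon_span_borelGens_of_last_eq_zero {c : Fin (n + 1) → ℤ} {a : Fin (n + 1) →₀ ℕ}
    (ha : a (Fin.last n) = 0) :
    (Ideal.span ((fun a => monomial a (1 : K)) '' borelGens c a)).colon
        (idealOfVars (Fin (n + 1)) K) =
      Ideal.span ((fun a => monomial a (1 : K)) '' borelGens c a) := by
  refine le_antisymm ?_ Ideal.le_colon
  rw [(IsMonomialIdeal.colon_idealOfVars ⟨_, rfl⟩).le_iff]
  intro v hv
  simp only [monomial_mem_colon_idealOfVars_iff, monomial_mem_span_iff] at hv ⊢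
  by_contra hnot
  have h := (mem_borelGens_of_socle hnot hv).1
  -- The last variable does not divide `u`, so that the prefix sum of `u` before it already is the
  -- degree, whereas that of the generator `x_N v` is smaller.
  have h0 : prefixSum (Fin.last n) a = prefixSum (Fin.last n) v + 1 := by
    rw [prefixSum_last, prefixSum_last, ← h.1]
    simp
  cases n with
  | zero =>
    rw [show Fin.last 0 = 0 from rfl] at h0 ha
    rw [prefixSum_zero, ha] at h0
    omega
  | succ m =>
    have h1 := h.2.1 (Fin.last m).castSucc
    rw [prefixSum_add, prefixSum_single, if_neg (by simp [Fin.le_def])] at h1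
    rw [← Fin.succ_last, prefixSum_succ, prefixSum_succ, Fin.succ_last, ha] at h0
    omega

theorem colon_span_borelGens {c : Fin (n + 1) → ℤ} {a : Fin (n + 1) →₀ ℕ}
    (ha : a (Fin.last n) ≠ 0) :
    (Ideal.span ((fun a => monomial a (1 : K)) '' borelGens c a)).colon
        (idealOfVars (Fin (n + 1)) K) =
      Ideal.span ((fun a => monomial a (1 : K)) '' borelGens c a) ⊔
        Ideal.span ((fun a => monomial a (1 : K)) ''
          borelGens (fun i => c i - 1) (a - Finsupp.single (Fin.last n) 1)) := by
  have hl : 1 ≤ a (Fin.last n) := Nat.one_le_iff_ne_zero.2 ha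
  have hiff := fun v => mem_borelGens_tsub_iff (c := c) (v := v) hl
  have hadd := fun v w => add_mem_borelGens_of_degree_eq (c := c) (v := v) (w := w) hl
  simp only [Nat.cast_one] at hiff hadd
  apply le_antisymm
  · rw [(IsMonomialIdeal.colon_idealOfVars ⟨_, rfl⟩).le_iff]
    intro v hv
    simp only [monomial_mem_colon_idealOfVars_iff, monomial_mem_span_iff] at hv
    by_cases hmem : ∃ b ∈ borelGens c a, b ≤ v
    · exact Ideal.mem_sup_left (monomial_mem_span_iff.2 hmem)
    · obtain ⟨h1, h2⟩ := mem_borelGens_of_socle hmem hv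
      refine Ideal.mem_sup_right (Ideal.subset_span ⟨v, (hiff v).2 ⟨?_, fun t ht => ?_, h2⟩, rfl⟩)
      · simpa using h1.1
      · have h3 := h1.2.1 t
        rwa [prefixSum_add, prefixSum_single, if_neg (fun h => ht (Fin.last_le_iff.1 h)),
          add_zero] at h3
  · refine sup_le Ideal.le_colon ?_
    rw [Ideal.span_le]
    rintro _ ⟨v, hv, rfl⟩
    refine monomial_mem_colon_idealOfVars_iff.2 fun j => Ideal.subset_span ⟨_, ?_, rfl⟩
    exact hadd v _ hv (by simp)

/-- The monomials in `(J : 𝔪^(l+1)) \ (J : 𝔪^l)` for `J = B^c(u)` are exactly the generators of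
`B^(c-(l+1)e)(u / x_N^(l+1))`. -/
theorem monomial_mem_colon_diff_iff {c : Fin (n + 1) → ℤ} {a v : Fin (n + 1) →₀ ℕ} {l : ℕ}
    (hl : l + 1 ≤ a (Fin.last n)) :
    (monomial v (1 : K) ∈ (Ideal.span ((fun a => monomial a (1 : K)) '' borelGens c a)).colon
        ↑(idealOfVars (Fin (n + 1)) K ^ (l + 1) : Ideal _) ∧
      monomial v (1 : K) ∉ (Ideal.span ((fun a => monomial a (1 : K)) '' borelGens c a)).colon
        ↑(idealOfVars (Fin (n + 1)) K ^ l : Ideal _)) ↔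
      v ∈ borelGens (fun i => c i - (l + 1 : ℕ)) (a - Finsupp.single (Fin.last n) (l + 1)) := by
  simp only [monomial_mem_colon_pow_iff, monomial_mem_span_iff]
  constructor
  · rintro ⟨h, hnot⟩
    push Not at hnot
    obtain ⟨w, hw, hvw⟩ := hnot
    have hdeg : v.degree + (l + 1) = a.degree := by
      have h1 := (mem_borelGens_of_socle (v := v + w) (by push Not; exact hvw) fun j => by
        rw [add_assoc]
        exact h _ (by simp [hw])).1.1
      simp only [map_add, hw, Finsupp.degree_single] at h1
      omega
    -- By degree reasons the products with monomials of degree `l + 1` are generators themselves.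
    have hgen : ∀ j, v + Finsupp.single j (l + 1) ∈ borelGens c a := by
      intro j
      obtain ⟨b, hb, hle⟩ := h (Finsupp.single j (l + 1)) (by simp)
      have := eq_of_le_of_degree_le hle (by rw [map_add, Finsupp.degree_single, hdeg, hb.1])
      exact this ▸ hb
    refine (mem_borelGens_tsub_iff hl).2 ⟨hdeg, fun t ht => ?_, fun i => ?_⟩
    · have h3 := (hgen (Fin.last n)).2.1 t
      rwa [prefixSum_add, prefixSum_single, if_neg (fun h => ht (Fin.last_le_iff.1 h)),
        add_zero] at h3
    · have h3 := (hgen i).2.2 i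
      simpa using h3
  · intro hv
    refine ⟨fun w hw => ⟨_, add_mem_borelGens_of_degree_eq hl hv hw, le_rfl⟩, fun h => ?_⟩
    obtain ⟨b, hb, hle⟩ := h (Finsupp.single 0 l) (by simp)
    have h1 := Finsupp.degree_mono hle
    have h2 := ((mem_borelGens_tsub_iff hl).1 hv).1
    rw [map_add, Finsupp.degree_single, hb.1] at h1
    omega

theorem socleIdeal_span_borelGens {c : Fin (n + 1) → ℤ} {a : Fin (n + 1) →₀ ℕ} {l : ℕ}
    (hl : l ≤ a (Fin.last n)) :
    socleIdeal (Ideal.span ((fun a => monomial a (1 : K)) '' borelGens c a)) l =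
      Ideal.span ((fun a => monomial a (1 : K)) ''
        borelGens (fun i => c i - l) (a - Finsupp.single (Fin.last n) l)) := by
  cases l with
  | zero => simp [socleIdeal]
  | succ l =>
    rw [socleIdeal]
    congr 2
    ext v
    exact monomial_mem_colon_diff_iff hl

end StableIdeal

theorem mainTheorem7 {n : ℕ} {K : Type*} [Field K] (c : Fin (n + 1) → ℤ)
    (a : Fin (n + 1) →₀ ℕ) (ha : IsBounded c a)
    (I : Ideal (MvPolynomial (Fin (n + 1)) K)) (hI : I = boundedBorel K c a)
    (k : ℕ) (hk : 0 < k) :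
    I ^ k = boundedBorel K (fun i => (k : ℤ) * c i) (k • a) ∧
    (a (Fin.last n) ≠ 0 →
      (I ^ k).colon (idealOfVars (Fin (n + 1)) K) =
        I ^ k ⊔ boundedBorel K (fun i => (k : ℤ) * c i - 1)
          (k • a - Finsupp.single (Fin.last n) 1)) ∧
    (a (Fin.last n) = 0 → (I ^ k).colon (idealOfVars (Fin (n + 1)) K) = I ^ k) ∧
    (∀ l : ℕ, l ≤ (k • a) (Fin.last n) →
      socleIdeal (I ^ k) l =
        boundedBorel K (fun i => (k : ℤ) * c i - (l : ℤ))
          (k • a - Finsupp.single (Fin.last n) l)) := by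
  have hpow : I ^ k = Ideal.span ((fun a => monomial a (1 : K)) ''
      borelGens (fun i => (k : ℤ) * c i) (k • a)) := by
    rw [hI, boundedBorel_eq_span, span_borelGens_pow]
  simp only [hpow, boundedBorel_eq_span, true_and]
  refine ⟨fun h => colon_span_borelGens ?_, fun h => colon_span_borelGens_of_last_eq_zero ?_,
    fun l hl => socleIdeal_span_borelGens hl⟩
  · simp [h, hk.ne']
  · simp [h]
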